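/- Notation. Let $1\le n\le N$. For an affine map $A:\mathbb{R}^n\to\mathbb{R}^N$ let $A'$ be its linear part, $\|A'\|$ the operator norm of $A'$, and $\lambda_1(A')\le\dots\le\lambda_n(A')$ the singular values of $A'$. A family $\mathcal{A}=\{A_{x,r}:x\in E,\ r>0\}$ of affine maps $A_{x,r}:\mathbb{R}^n\to\mathbb{R}^N$ over a set $E\subset\mathbb{R}^n$ is called $\varepsilon$-compatible ($\varepsilon>0$) if $\|A_{x,r}'-A_{y,s}'\|\le\varepsilon\min\{\|A_{x,r}'\|,\|A_{y,s}'\|\}$ for all $x,y\in E$ and $r,s>0$ with $|x-y|\le\max\{r,s\}$ and $1/2\le r/s\le2$. For $E\subset X\subset\mathbb{R}^n$ and $f:X\to\mathbb{R}^N$, we say that $(f,E,\mathcal{A})$ is $\varepsilon$-almost affine if $\mathcal{A}$ is an $\varepsilon$-compatible family of affine maps over $E$ and $$\sup_{z\in E\cap B^n(x,r)}|f(z)-A_{x,r}(z)|\le\varepsilon\|A_{x,r}'\|\,r\quad\text{for all }x\in E,\ r>0,$$ where $B^n(x,r)$ is the closed ball; $f$ is $\varepsilon$-almost affine over $E$ if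 such a family $\mathcal{A}$ exists. A map $F:\mathbb{R}^n\to\mathbb{R}^N$ is weakly $K$-quasisymmetric if it is a homeomorphism onto its image and the infimum of all $K'\ge1$ such that $|a-x|\le|b-x|$ implies $|F(a)-F(x)|\le K'|F(b)-F(x)|$ for all $a,b,x\in\mathbb{R}^n$ is finite and at most $K$. Theorem. For every $n\ge1$ there is a constant $C_1=C_1(n)>0$, and for all $1\le H<\infty$ and $1<\rho\le2$ there is $\varepsilon_1=\varepsilon_1(n,H,\rho)>0$, with the following property. If $N\ge n$, $E\subsetneq\mathbb{R}^n$ is closed, $f:E\to\mathbb{R}^N$ is nonconstant, and $(f,E,\mathcal{A})$ is $\varepsilon$-almost affine for some $0<\varepsilon\le\varepsilon_1$ and some family $\mathcal{A}$ such that $$\lambda_n(A_{x,r}')\le H\lambda_1(A_{x,r}')\quad\text{for all }x\in E\text{ and }r>0,$$ then there exist a map $F:\mathbb{R}^n\to\mathbb{R}^N$ and a family $\mathcal{A}^+=\{A_{x,r}^+:x\in\mathbb{R}^n,\ r>0\}$ of affine maps over $\mathbb{R}^n$ with $F|_E=f$ and $A_{x,r}^+=A_{x,r}$ for all $x\in E$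 and $r>0$, such that $(F,\mathbb{R}^n,\mathcal{A}^+)$ is $C_1\varepsilon$-almost affine (in particular $F$ is $C_1\varepsilon$-almost affine over $\mathbb{R}^n$), $F$ is weakly $\rho H$-quasisymmetric, and $$\lambda_n\big((A_{x,r}^+)'\big)\le\frac{\rho+1}{2}\,H\,\lambda_1\big((A_{x,r}^+)'\big)\quad\text{for all }x\in\mathbb{R}^n\text{ and }r>0.$$ -/

import Mathlib

/-- Euclidean `n`-space with its Euclidean norm. -/
abbrev Euc (n : ℕ) : Type := EuclideanSpace ℝ (Fin n)

/-- For an affine map `A : ℝⁿ → ℝᴺ` and `1 ≤ k ≤ n`, the `k`-th singular value `λ_k(A')` of the linear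
part `A'` of `A`, numbered so that `λ_1(A') ≤ ⋯ ≤ λ_n(A')`. (Mathlib lists the `n` singular values
in decreasing order with indices `0, …, n - 1`.) -/
noncomputable def affSingularValue {n N : ℕ} (k : ℕ) (A : Euc n →ᴬ[ℝ] Euc N) : ℝ :=
  (A.contLinear : Euc n →ₗ[ℝ] Euc N).singularValues (n - k)

/-- The family `{A_{x,r} : x ∈ E, r > 0}` of affine maps over `E` is `ε`-compatible. Here
`‖(A x r).contLinear‖` is the operator norm of the linear part of `A_{x,r}`. Families are encoded as
total functions; the values at `x ∉ E` or `r ≤ 0` play no role. -/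
def IsCompatibleFamily {n N : ℕ} (ε : ℝ) (E : Set (Euc n)) (A : Euc n → ℝ → (Euc n →ᴬ[ℝ] Euc N)) :
    Prop :=
  0 < ε ∧ ∀ x ∈ E, ∀ y ∈ E, ∀ r > 0, ∀ s > 0,
    dist x y ≤ max r s → 1 / 2 ≤ r / s → r / s ≤ 2 →
      ‖(A x r).contLinear - (A y s).contLinear‖ ≤
        ε * min ‖(A x r).contLinear‖ ‖(A y s).contLinear‖

/-- `(f, E, A)` is `ε`-almost affine: `A` is an `ε`-compatible family of affine maps over `E`, and
`sup {|f z - A_{x,r} z| : z ∈ E ∩ B(x,r)} ≤ ε ‖A_{x,r}'‖ r` for all `x ∈ E` and `r > 0`, where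
`B(x,r)` is the closed ball. Only the values of `f` on `E` matter. -/
def IsAlmostAffine {n N : ℕ} (ε : ℝ) (f : Euc n → Euc N) (E : Set (Euc n))
    (A : Euc n → ℝ → (Euc n →ᴬ[ℝ] Euc N)) : Prop :=
  IsCompatibleFamily ε E A ∧
    ∀ x ∈ E, ∀ r > 0, ∀ z ∈ E ∩ Metric.closedBall x r,
      ‖f z - A x r z‖ ≤ ε * ‖(A x r).contLinear‖ * r

/-- `f` is `ε`-almost affine over `E`: `(f, E, A)` is `ε`-almost affine for some family `A`. -/
def IsAlmostAffineOver {n N : ℕ} (ε : ℝ) (f : Euc n → Euc N) (E : Set (Euc n)) : Prop :=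
  ∃ A : Euc n → ℝ → (Euc n →ᴬ[ℝ] Euc N), IsAlmostAffine ε f E A

/-- The set of `H ≥ 1` such that `d(a,x) ≤ d(b,x)` implies `d(f a, f x) ≤ H d(f b, f x)`. -/
def weakQSBounds {X Y : Type*} [MetricSpace X] [MetricSpace Y] (f : X → Y) : Set ℝ :=
  {H | 1 ≤ H ∧ ∀ a b x : X, dist a x ≤ dist b x → dist (f a) (f x) ≤ H * dist (f b) (f x)}

/-- A weakly quasisymmetric map is a topological embedding with finite weak quasisymmetry constant
`H_f(X)`, the infimum of `weakQSBounds f`; it is finite iff that set is nonempty. -/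
def IsWeaklyQuasisymmetric {X Y : Type*} [MetricSpace X] [MetricSpace Y] (f : X → Y) : Prop :=
  Topology.IsEmbedding f ∧ (weakQSBounds f).Nonempty

/-- A weakly `H`-quasisymmetric map is a weakly quasisymmetric map with `H_f(X) ≤ H`. -/
def IsWeaklyQuasisymmetricWith {X Y : Type*} [MetricSpace X] [MetricSpace Y] (H : ℝ) (f : X → Y) :
    Prop :=
  IsWeaklyQuasisymmetric f ∧ sInf (weakQSBounds f) ≤ H

/-! This is a Whitney extension. Let `d` be the distance to `E` and `π x` a nearest point of `E`.
Off `E`, `F` blends the maps `A (π c) σ` by a partition of unity whose members at scale `σ` live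
where `d` is comparable to `σ`, near a lattice point `c`. Compatibility makes all the maps blended
near `x` agree up to `O(ε)` in relative terms, with constants depending only on `n`.

Two estimates follow. On a ball centred in `E` the blend stays `O(ε)`-close to the given affine map
(`norm_tentExtension_sub_le`). Off `E`, at scales below `d x / 2`, the increment of `F` is linear up
to `O(ε)` times the displacement, because the weights have Lipschitz constant `O(1 / d x)`
(`norm_tentExtension_sub_sub_le`). Larger balls off `E` are moved to a nearest point.

The linear part of the new family at `(x, r)` is that of `A` at `π x` and scale `max r (d x)`, so
distortion and nonvanishing are inherited. An almost affine map on the whole space with such linear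
parts is weakly quasisymmetric: increments at one point and scale are compared through a single
linear map. -/

/-! ### Extreme singular values as bounds on a linear map -/

theorem LinearMap.norm_sq_apply_eq_sum_singularValues {E F : Type*}
    [NormedAddCommGroup E] [InnerProductSpace ℝ E] [FiniteDimensional ℝ E]
    [NormedAddCommGroup F] [InnerProductSpace ℝ F] [FiniteDimensional ℝ F]
    (T : E →ₗ[ℝ] F) {n : ℕ} (hn : Module.finrank ℝ E = n) (v : E) :
    ‖T v‖ ^ 2 = ∑ i : Fin n, T.singularValues i ^ 2 *
      (T.isSymmetric_adjoint_comp_self.eigenvectorBasis hn).repr v i ^ 2 := by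
  have hT := T.isSymmetric_adjoint_comp_self
  have h1 : ‖T v‖ ^ 2 = inner ℝ ((LinearMap.adjoint T ∘ₗ T) v) v := by
    rw [LinearMap.comp_apply, LinearMap.adjoint_inner_left, real_inner_self_eq_norm_sq]
  -- Expand in an eigenbasis of `T* T`, whose eigenvalues are the squared singular values.
  rw [h1, ← (hT.eigenvectorBasis hn).repr.inner_map_map, PiLp.inner_apply]
  refine Finset.sum_congr rfl fun i _ => ?_
  rw [hT.eigenvectorBasis_apply_self_apply hn v i, T.sq_singularValues_fin hn i]
  simp only [RCLike.inner_apply, conj_trivial, RCLike.ofReal_real_eq_id, id_eq]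
  ring

theorem norm_contLinear_apply_le_affSingularValue {n N : ℕ}
    (A : Euc n →ᴬ[ℝ] Euc N) (v : Euc n) :
    ‖A.contLinear v‖ ≤ affSingularValue n A * ‖v‖ := by
  set T : Euc n →ₗ[ℝ] Euc N := (A.contLinear : Euc n →ₗ[ℝ] Euc N) with hTdef
  have hfin : Module.finrank ℝ (Euc n) = n := by simp
  have h0 : 0 ≤ affSingularValue n A := LinearMap.singularValues_nonneg _ _
  refine (pow_le_pow_iff_left₀ (by positivity) (by positivity) two_ne_zero).1 ?_
  have := T.norm_sq_apply_eq_sum_singularValues hfin v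
  set b := T.isSymmetric_adjoint_comp_self.eigenvectorBasis hfin
  have hv : ‖v‖ ^ 2 = ∑ i, b.repr v i ^ 2 := by
    rw [← b.repr.norm_map, EuclideanSpace.real_norm_sq_eq]
  change ‖T v‖ ^ 2 ≤ _
  rw [this, mul_pow, hv, Finset.mul_sum]
  refine Finset.sum_le_sum fun i _ => ?_
  have h2 : T.singularValues i ≤ affSingularValue n A := by
    unfold affSingularValue
    exact T.singularValues_antitone (by simp)
  have := T.singularValues_nonneg i
  gcongr

theorem affSingularValue_mul_norm_le_norm_contLinear_apply {n N : ℕ} (hn : 1 ≤ n)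
    (A : Euc n →ᴬ[ℝ] Euc N) (v : Euc n) :
    affSingularValue 1 A * ‖v‖ ≤ ‖A.contLinear v‖ := by
  set T : Euc n →ₗ[ℝ] Euc N := (A.contLinear : Euc n →ₗ[ℝ] Euc N) with hTdef
  have hfin : Module.finrank ℝ (Euc n) = n := by simp
  have h0 : 0 ≤ affSingularValue 1 A := LinearMap.singularValues_nonneg _ _
  refine (pow_le_pow_iff_left₀ (by positivity) (by positivity) two_ne_zero).1 ?_
  have := T.norm_sq_apply_eq_sum_singularValues hfin v
  set b := T.isSymmetric_adjoint_comp_self.eigenvectorBasis hfin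
  have hv : ‖v‖ ^ 2 = ∑ i, b.repr v i ^ 2 := by
    rw [← b.repr.norm_map, EuclideanSpace.real_norm_sq_eq]
  change _ ≤ ‖T v‖ ^ 2
  rw [this, mul_pow, hv, Finset.mul_sum]
  refine Finset.sum_le_sum fun i _ => ?_
  have h2 : affSingularValue 1 A ≤ T.singularValues i := by
    unfold affSingularValue
    exact T.singularValues_antitone (by omega)
  gcongr

/-- `‖L‖ ‖v‖ ≤ H ‖L v‖` when the extreme singular values of `L` have ratio at most `H`. -/
theorem norm_contLinear_mul_norm_le {n N : ℕ} (hn : 1 ≤ n) {H : ℝ} (hH : 0 ≤ H)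
    {A : Euc n →ᴬ[ℝ] Euc N} (hA : affSingularValue n A ≤ H * affSingularValue 1 A) (v : Euc n) :
    ‖A.contLinear‖ * ‖v‖ ≤ H * ‖A.contLinear v‖ := by
  have h0 : 0 ≤ affSingularValue n A := LinearMap.singularValues_nonneg _ _
  have h1 : ‖A.contLinear‖ ≤ affSingularValue n A :=
    A.contLinear.opNorm_le_bound h0 (norm_contLinear_apply_le_affSingularValue A)
  have h2 := affSingularValue_mul_norm_le_norm_contLinear_apply hn A v
  calc ‖A.contLinear‖ * ‖v‖ ≤ H * affSingularValue 1 A * ‖v‖ := by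
        gcongr; exact h1.trans hA
    _ = H * (affSingularValue 1 A * ‖v‖) := by ring
    _ ≤ _ := by gcongr

/-! ### Chains of relatively close vectors -/

/-- `L` and `M` differ by at most `a - 1` times the smaller of their norms. -/
def Near {V : Type*} [NormedAddCommGroup V] (a : ℝ) (L M : V) : Prop :=
  ‖L - M‖ ≤ (a - 1) * min ‖L‖ ‖M‖

namespace Near

variable {V : Type*} [NormedAddCommGroup V] {a b : ℝ} {L M K : V}

theorem refl (L : V) : Near 1 L L := by simp [Near]

theorem symm (h : Near a L M) : Near a M L := by
  unfold Near at *
  rwa [norm_sub_rev, min_comm]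

theorem mono (h : Near a L M) (hab : a ≤ b) : Near b L M := by
  unfold Near at *
  exact h.trans (by gcongr)

theorem norm_sub_le_right (h : Near a L M) (ha : 1 ≤ a) : ‖L - M‖ ≤ (a - 1) * ‖M‖ :=
  h.trans (mul_le_mul_of_nonneg_left (min_le_right _ _) (by linarith))

theorem norm_le_right (h : Near a L M) (ha : 1 ≤ a) : ‖L‖ ≤ a * ‖M‖ := by
  have := h.norm_sub_le_right ha
  have h2 := norm_sub_norm_le L M
  linarith

theorem trans_aux (h : Near a L M) (h' : Near b M K) (ha : 1 ≤ a) (hb : 1 ≤ b) :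
    ‖L - K‖ ≤ (a * b - 1) * ‖K‖ := by
  have h1 := h.norm_sub_le_right ha
  have h2 := h'.norm_sub_le_right hb
  have h3 := h'.norm_le_right hb
  have h4 := norm_sub_le_norm_sub_add_norm_sub L M K
  have h5 : (a - 1) * ‖M‖ ≤ (a - 1) * (b * ‖K‖) := mul_le_mul_of_nonneg_left h3 (by linarith)
  linarith

/-- Measuring closeness by `a - 1` makes constants multiply along a chain, since `(a - 1) * b + (b -
1) = a * b - 1`. -/
theorem trans (h : Near a L M) (h' : Near b M K) (ha : 1 ≤ a) (hb : 1 ≤ b) :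
    Near (a * b) L K := by
  have h1 := trans_aux h h' ha hb
  have h2 := trans_aux h'.symm h.symm hb ha
  rw [norm_sub_rev, mul_comm b a] at h2
  unfold Near
  rcases le_total ‖L‖ ‖K‖ with h | h
  · rwa [min_eq_left h]
  · rwa [min_eq_right h]

end Near

/-- The right side is the chord of the convex function `(1 + ε) ^ k` over `[0, 1]`. It keeps the
error of a chain linear in `ε`. -/
theorem one_add_pow_le {ε : ℝ} (h0 : 0 ≤ ε) (h1 : ε ≤ 1) (k : ℕ) :
    (1 + ε) ^ k ≤ 1 + ε * (2 ^ k - 1) := by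
  induction k with
  | zero => simp
  | succ k ih =>
    have h2 : (1 : ℝ) ≤ 2 ^ k := one_le_pow₀ (by norm_num)
    calc (1 + ε) ^ (k + 1) = (1 + ε) ^ k * (1 + ε) := pow_succ _ _
      _ ≤ (1 + ε * (2 ^ k - 1)) * (1 + ε) := by gcongr
      _ ≤ _ := by
        rw [pow_succ]
        nlinarith [mul_nonneg (mul_nonneg h0 (sub_nonneg.2 h1)) (sub_nonneg.2 h2)]

theorem Near.norm_sub_le_of_pow {V : Type*} [NormedAddCommGroup V] {L M : V} {ε : ℝ} {k : ℕ}
    (h : Near ((1 + ε) ^ k) L M) (h0 : 0 ≤ ε) (h1 : ε ≤ 1) :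
    ‖L - M‖ ≤ ε * 2 ^ k * ‖M‖ := by
  refine (h.norm_sub_le_right (one_le_pow₀ (by linarith))).trans ?_
  have := one_add_pow_le h0 h1 k
  gcongr
  linarith

/-! ### Comparing linear parts across points and scales -/

namespace IsCompatibleFamily

variable {n N : ℕ} {ε : ℝ} {E : Set (Euc n)} {A : Euc n → ℝ → (Euc n →ᴬ[ℝ] Euc N)}

theorem near (hA : IsCompatibleFamily ε E A) {p q : Euc n} (hp : p ∈ E) (hq : q ∈ E) {r s : ℝ}
    (hr : 0 < r) (hs : 0 < s) (hpq : dist p q ≤ max r s) (h1 : r ≤ 2 * s) (h2 : s ≤ 2 * r) :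
    Near (1 + ε) (A p r).contLinear (A q s).contLinear := by
  have := hA.2 p hp q hq r hr s hs hpq (by rw [div_le_div_iff₀ (by norm_num) hs]; linarith)
    (by rw [div_le_iff₀ hs]; exact h1)
  unfold Near
  rwa [add_sub_cancel_left]

theorem near_scale (hA : IsCompatibleFamily ε E A) {p : Euc n} (hp : p ∈ E) (k : ℕ) {s t : ℝ}
    (hs : 0 < s) (hst : s ≤ t) (ht : t ≤ 2 ^ k * s) :
    Near ((1 + ε) ^ k) (A p s).contLinear (A p t).contLinear := by
  have hε := hA.1
  induction k generalizing s with
  | zero =>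
    have : t = s := le_antisymm (by simpa using ht) hst
    subst this
    simpa using Near.refl _
  | succ k ih =>
    by_cases h : t ≤ 2 * s
    · exact (hA.near hp hp hs (hs.trans_le hst) (by simp [hs.le]) (by linarith) h).mono
        (le_self_pow₀ (by linarith) (by omega))
    · have h1 := hA.near hp hp hs (by linarith : 0 < 2 * s) (by simp [hs.le]) (by linarith) le_rfl
      have h2 := ih (s := 2 * s) (by linarith) (by linarith) (by rw [pow_succ] at ht; linarith)
      rw [pow_succ']
      exact h1.trans h2 (by linarith) (one_le_pow₀ (by linarith))

/-- Double both scales up to `T`, where compatibility links `p` and `q` in one step. -/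
theorem near_of_common_scale (hA : IsCompatibleFamily ε E A) {p q : Euc n} (hp : p ∈ E)
    (hq : q ∈ E) {j k : ℕ} {r s T : ℝ} (hr : 0 < r) (hs : 0 < s) (hpq : dist p q ≤ T)
    (hrT : r ≤ T) (hsT : s ≤ T) (hTr : T ≤ 2 ^ j * r) (hTs : T ≤ 2 ^ k * s) :
    Near ((1 + ε) ^ (j + 1 + k)) (A p r).contLinear (A q s).contLinear := by
  have hε := hA.1
  have hT : 0 < T := hr.trans_le hrT
  have h1 : (1 : ℝ) ≤ 1 + ε := by linarith
  have := ((hA.near_scale hp j hr hrT hTr).trans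
    (hA.near hp hq hT hT (by simpa using hpq) (by linarith) (by linarith)) (one_le_pow₀ h1) h1).trans
    (hA.near_scale hq k hs hsT hTs).symm (one_le_mul_of_one_le_of_one_le (one_le_pow₀ h1) h1) (one_le_pow₀ h1)
  rwa [← pow_succ, ← pow_add] at this

/-- No lower bound on `s / T` is needed: climbing from `s` to `T` costs a factor of order `T / s`,
which the weight `s` absorbs. -/
theorem norm_sub_mul_scale_le (hA : IsCompatibleFamily ε E A) (hε1 : ε ≤ 1) {p q : Euc n}
    (hp : p ∈ E) (hq : q ∈ E) {k : ℕ} {r s T : ℝ} (hr : 0 < r) (hs : 0 < s)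
    (hpq : dist p q ≤ T) (hrT : r ≤ T) (hsT : s ≤ T) (hTr : T ≤ 2 ^ k * r) :
    ‖(A q s).contLinear - (A p r).contLinear‖ * s ≤
      ε * 2 ^ (k + 2) * ‖(A p r).contLinear‖ * T := by
  have hε := hA.1
  obtain ⟨m, hm1, hm2⟩ := exists_nat_pow_near (show 1 ≤ T / s by rw [le_div_iff₀ hs]; linarith)
    (by norm_num : (1 : ℝ) < 2)
  rw [le_div_iff₀ hs] at hm1
  rw [div_lt_iff₀ hs] at hm2
  have h := (hA.near_of_common_scale hq hp hs hr (by rwa [dist_comm]) hsT hrT hm2.le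
    hTr).norm_sub_le_of_pow hε.le hε1
  calc _ ≤ ε * 2 ^ (m + 1 + 1 + k) * ‖(A p r).contLinear‖ * s := by gcongr
    _ = ε * 2 ^ (k + 2) * ‖(A p r).contLinear‖ * (2 ^ m * s) := by ring
    _ ≤ _ := by gcongr

/-- Compatibility links any two members of the family, so one vanishing linear part forces all
of them to vanish. -/
theorem contLinear_eq_zero (hA : IsCompatibleFamily ε E A) {p q : Euc n} (hp : p ∈ E)
    (hq : q ∈ E) {r s : ℝ} (hr : 0 < r) (hs : 0 < s) (h : (A p r).contLinear = 0) :
    (A q s).contLinear = 0 := by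
  have hε := hA.1
  set T := max (dist q p) (max r s)
  obtain ⟨j, hj⟩ := pow_unbounded_of_one_lt (T / r) (by norm_num : (1 : ℝ) < 2)
  obtain ⟨k, hk⟩ := pow_unbounded_of_one_lt (T / s) (by norm_num : (1 : ℝ) < 2)
  rw [div_lt_iff₀ hr] at hj
  rw [div_lt_iff₀ hs] at hk
  have := (hA.near_of_common_scale hq hp hs hr (T := T) (le_max_left _ _)
    ((le_max_right _ _).trans (le_max_right _ _)) ((le_max_left _ _).trans (le_max_right _ _))
    hk.le hj.le).norm_le_right (one_le_pow₀ (by linarith))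
  simpa [h] using this

end IsCompatibleFamily

/-! ### Comparing affine maps of an almost affine triple -/

namespace IsAlmostAffine

variable {n N : ℕ} {ε : ℝ} {E : Set (Euc n)} {f : Euc n → Euc N}
  {A : Euc n → ℝ → (Euc n →ᴬ[ℝ] Euc N)}

theorem mono {δ : ℝ} (h : IsAlmostAffine ε f E A) (hδ : ε ≤ δ) : IsAlmostAffine δ f E A := by
  refine ⟨⟨h.1.1.trans_le hδ, fun x hx y hy r hr s hs h1 h2 h3 =>
    (h.1.2 x hx y hy r hr s hs h1 h2 h3).trans (by gcongr)⟩, fun x hx r hr z hz =>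
    (h.2 x hx r hr z hz).trans (by gcongr)⟩

/-- One zero linear part makes all of them zero; the approximation errors then vanish too, and `f`
would be constant. -/
theorem contLinear_ne_zero (h : IsAlmostAffine ε f E A) (hf : ∃ x ∈ E, ∃ y ∈ E, f x ≠ f y)
    {p : Euc n} (hp : p ∈ E) {r : ℝ} (hr : 0 < r) : (A p r).contLinear ≠ 0 := by
  intro h0
  obtain ⟨x, hx, y, hy, hxy⟩ := hf
  have hd : 0 < dist y x := dist_pos.2 fun h => hxy (by rw [h])
  have hz := h.1.contLinear_eq_zero hp hx hr hd h0
  have h1 := h.2 x hx _ hd x ⟨hx, by simp⟩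
  have h2 := h.2 x hx _ hd y ⟨hy, by simp⟩
  have h3 := (A x (dist y x)).contLinear_map_vsub y x
  simp only [hz, norm_zero, mul_zero, zero_mul, norm_le_zero_iff, sub_eq_zero] at h1 h2
  apply hxy
  simp only [hz, zero_apply, vsub_eq_sub] at h3
  rw [h1, h2]
  exact (sub_eq_zero.1 h3.symm).symm

theorem norm_apply_sub_apply_le (h : IsAlmostAffine ε f E A) (hε1 : ε ≤ 1) {p q z : Euc n}
    (hp : p ∈ E) (hq : q ∈ E) {k : ℕ} {r s T Λ : ℝ} (hr : 0 < r) (hs : 0 < s) (hΛ : 0 ≤ Λ)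
    (hpq : dist p q ≤ T) (hrT : r ≤ T) (hsT : s ≤ T) (hTr : T ≤ 2 ^ k * r)
    (hz : dist z q ≤ Λ * s) :
    ‖A q s z - A p r z‖ ≤ (Λ + 6) * (1 + 2 ^ (k + 2)) * (ε * ‖(A p r).contLinear‖ * T) := by
  have hε := h.1.1
  have hT : 0 < T := hr.trans_le hrT
  set a := ‖(A p r).contLinear‖ with ha
  set M : ℝ := 2 ^ (k + 2) with hM
  have hM0 : 0 < M := by positivity
  have ha0 : 0 ≤ a := norm_nonneg _
  have hd1 := h.1.norm_sub_mul_scale_le hε1 hp hq hr hs hpq hrT hsT hTr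
  have hd2 : ‖(A p T).contLinear - (A p r).contLinear‖ * T ≤ ε * M * a * T :=
    h.1.norm_sub_mul_scale_le hε1 hp hp hr hT (by simpa using hT.le) hrT le_rfl hTr
  have hn1 : ‖(A q s).contLinear‖ * s ≤ (1 + M) * a * T := by
    have h1 : ‖(A q s).contLinear‖ ≤ ‖(A q s).contLinear - (A p r).contLinear‖ + a := by
      simpa using norm_add_le ((A q s).contLinear - (A p r).contLinear) (A p r).contLinear
    calc _ ≤ (‖(A q s).contLinear - (A p r).contLinear‖ + a) * s := by gcongr
      _ = ‖(A q s).contLinear - (A p r).contLinear‖ * s + a * s := by ring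
      _ ≤ 1 * M * a * T + a * T := by
        refine add_le_add (hd1.trans (by gcongr)) (by gcongr)
      _ = _ := by ring
  have hn2 : ‖(A p T).contLinear‖ * T ≤ (1 + M) * a * T := by
    have h1 : ‖(A p T).contLinear‖ ≤ ‖(A p T).contLinear - (A p r).contLinear‖ + a := by
      simpa using norm_add_le ((A p T).contLinear - (A p r).contLinear) (A p r).contLinear
    calc _ ≤ (‖(A p T).contLinear - (A p r).contLinear‖ + a) * T := by gcongr
      _ = ‖(A p T).contLinear - (A p r).contLinear‖ * T + a * T := by ring
      _ ≤ 1 * M * a * T + a * T := by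
        refine add_le_add (hd2.trans (by gcongr)) le_rfl
      _ = _ := by ring
  have e1 := h.2 q hq s hs q ⟨hq, by simpa using hs.le⟩
  have e2 := h.2 p hp T hT q ⟨hq, by simpa [dist_comm] using hpq⟩
  have e3 := h.2 p hp T hT p ⟨hp, by simpa using hT.le⟩
  have e4 := h.2 p hp r hr p ⟨hp, by simpa using hr.le⟩
  have e5 : ‖((A p T).contLinear - (A p r).contLinear) (q - p)‖ ≤ ε * M * a * T := by
    refine (ContinuousLinearMap.le_opNorm _ _).trans (le_trans ?_ hd2)
    gcongr
    rwa [← dist_eq_norm, dist_comm]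
  have e6 : ‖((A q s).contLinear - (A p r).contLinear) (z - q)‖ ≤ Λ * (ε * M * a * T) := by
    rw [dist_eq_norm] at hz
    refine (ContinuousLinearMap.le_opNorm _ _).trans ?_
    calc _ ≤ ‖(A q s).contLinear - (A p r).contLinear‖ * (Λ * s) := by gcongr
      _ = Λ * (‖(A q s).contLinear - (A p r).contLinear‖ * s) := by ring
      _ ≤ _ := by gcongr
  -- The detour through `A p T` is needed because `q` lies within `T` of `p` but possibly outside
  -- the ball of radius `r`.
  have key : A q s z - A p r z = -(f q - A q s q) + (f q - A p T q) - (f p - A p T p)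
      + (f p - A p r p) + ((A p T).contLinear - (A p r).contLinear) (q - p)
      + ((A q s).contLinear - (A p r).contLinear) (z - q) := by
    have i1 := (A q s).contLinear_map_vsub z q
    have i2 := (A p r).contLinear_map_vsub z q
    have i3 := (A p T).contLinear_map_vsub q p
    have i4 := (A p r).contLinear_map_vsub q p
    simp only [vsub_eq_sub] at i1 i2 i3 i4
    rw [sub_apply, sub_apply, i1, i2, i3, i4]
    abel
  have tri : ‖A q s z - A p r z‖ ≤ ‖f q - A q s q‖ + ‖f q - A p T q‖ + ‖f p - A p T p‖
      + ‖f p - A p r p‖ + ‖((A p T).contLinear - (A p r).contLinear) (q - p)‖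
      + ‖((A q s).contLinear - (A p r).contLinear) (z - q)‖ := by
    rw [key]
    refine (norm_add_le _ _).trans (add_le_add_left ?_ _)
    refine (norm_add_le _ _).trans (add_le_add_left ?_ _)
    refine (norm_add_le _ _).trans (add_le_add_left ?_ _)
    refine (norm_sub_le _ _).trans (add_le_add_left ?_ _)
    refine (norm_add_le _ _).trans (add_le_add_left ?_ _)
    rw [norm_neg]
  have hX : 0 ≤ ε * a * T := by positivity
  have f1 : ε * (‖(A q s).contLinear‖ * s) ≤ ε * ((1 + M) * a * T) := by gcongr
  have f2 : ε * (‖(A p T).contLinear‖ * T) ≤ ε * ((1 + M) * a * T) := by gcongr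
  have f4 : ε * a * r ≤ ε * a * T := by gcongr
  have f5 : 0 ≤ Λ * (ε * a * T) := by positivity
  have f6 : 0 ≤ M * (ε * a * T) := by positivity
  have f7 : 0 ≤ Λ * M * (ε * a * T) := by positivity
  nlinarith

end IsAlmostAffine

/-! ### From almost affine to weakly quasisymmetric -/

/-- A map with `ε`-almost affine behaviour at all points and scales of `ℝⁿ`, with nonzero linear
parts of bounded distortion, is weakly quasisymmetric. -/
theorem IsAlmostAffine.isWeaklyQuasisymmetricWith {n N : ℕ} (hn : 1 ≤ n) {δ H ρ : ℝ} (hH : 1 ≤ H)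
    (hρ : 1 ≤ ρ) (hδ : 1 + 2 * δ ≤ ρ * (1 - 2 * δ * H)) (hδ' : δ ≤ 1 / 2)
    {F : Euc n → Euc N} {A : Euc n → ℝ → (Euc n →ᴬ[ℝ] Euc N)} (h : IsAlmostAffine δ F Set.univ A)
    (hA0 : ∀ x, ∀ r > 0, (A x r).contLinear ≠ 0)
    (hA : ∀ x, ∀ r > 0, ∀ v, ‖(A x r).contLinear‖ * ‖v‖ ≤ H * ‖(A x r).contLinear v‖) :
    IsWeaklyQuasisymmetricWith (ρ * H) F := by
  have hδ0 := h.1.1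
  have err : ∀ x z : Euc n, ∀ r > 0, dist z x ≤ r →
      ‖F z - F x - (A x r).contLinear (z - x)‖ ≤ 2 * δ * ‖(A x r).contLinear‖ * r := by
    intro x z r hr hz
    have h1 := h.2 x trivial r hr z ⟨trivial, hz⟩
    have h2 := h.2 x trivial r hr x ⟨trivial, by simpa using hr.le⟩
    have i := (A x r).contLinear_map_vsub z x
    rw [vsub_eq_sub, vsub_eq_sub] at i
    rw [i]
    calc _ = ‖(F z - A x r z) - (F x - A x r x)‖ := by congr 1; abel
      _ ≤ _ := (norm_sub_le _ _).trans (by linarith)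
  have upper : ∀ x z : Euc n, ∀ r > 0, dist z x ≤ r →
      dist (F z) (F x) ≤ (1 + 2 * δ) * (‖(A x r).contLinear‖ * r) := by
    intro x z r hr hz
    have h1 := err x z r hr hz
    have h2 : ‖(A x r).contLinear (z - x)‖ ≤ ‖(A x r).contLinear‖ * r := by
      refine (ContinuousLinearMap.le_opNorm _ _).trans ?_
      rw [← dist_eq_norm]
      gcongr
    have h3 := norm_add_le (F z - F x - (A x r).contLinear (z - x)) ((A x r).contLinear (z - x))
    rw [sub_add_cancel] at h3
    rw [dist_eq_norm]
    linarith
  -- Taking the scale equal to `dist b x` gives the linear term its full size, and the left side is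
  -- the value of `upper` at that scale.
  have lower : ∀ x b : Euc n, b ≠ x →
      (1 + 2 * δ) * (‖(A x (dist b x)).contLinear‖ * dist b x) ≤
        ρ * H * dist (F b) (F x) := by
    intro x b hb
    have hr : 0 < dist b x := dist_pos.2 hb
    set r := dist b x with hrdef
    have h1 := err x b r hr le_rfl
    have h2 := hA x r hr (b - x)
    rw [← dist_eq_norm, ← hrdef] at h2
    have h3 := norm_sub_le (F b - F x) (F b - F x - (A x r).contLinear (b - x))
    rw [sub_sub_cancel] at h3
    rw [← dist_eq_norm] at h3
    have h4 : ‖(A x r).contLinear‖ * r * (1 - 2 * δ * H) ≤ H * dist (F b) (F x) := by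
      nlinarith
    have h5 : 0 ≤ ‖(A x r).contLinear‖ * r := by positivity
    nlinarith
  have bound : ρ * H ∈ weakQSBounds F := by
    refine ⟨by nlinarith, fun a b x hab => ?_⟩
    by_cases hb : b = x
    · subst hb
      have : a = b := by simpa using hab
      simp [this]
    · exact (upper x a _ (dist_pos.2 hb) hab).trans (lower x b hb)
  have pos : ∀ x b : Euc n, b ≠ x → 0 < dist (F b) (F x) := by
    intro x b hb
    have h1 := lower x b hb
    have h2 : 0 < ‖(A x (dist b x)).contLinear‖ := norm_pos_iff.2 (hA0 x _ (dist_pos.2 hb))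
    have h3 := dist_pos.2 hb
    have h4 : 0 < (1 + 2 * δ) * (‖(A x (dist b x)).contLinear‖ * dist b x) := by positivity
    exact pos_of_mul_pos_right (h4.trans_le h1) (by positivity)
  have inj : Function.Injective F := by
    intro b x hbx
    by_contra hne
    exact (pos x b hne).ne' (by simp [hbx])
  have cont : Continuous F := by
    rw [Metric.continuous_iff]
    intro x η hη
    -- Each halving of the scale multiplies the norm of the linear part by at most `1 + δ ≤ 3 / 2`,
    -- so norm times scale decays like `(3 / 4) ^ k`.
    have hlim : Filter.Tendsto (fun k : ℕ => (1 + 2 * δ) * ‖(A x 1).contLinear‖ * (3 / 4 : ℝ) ^ k)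
        Filter.atTop (nhds 0) := by
      simpa using (tendsto_pow_atTop_nhds_zero_of_lt_one (by norm_num : (0 : ℝ) ≤ 3 / 4)
        (by norm_num)).const_mul ((1 + 2 * δ) * ‖(A x 1).contLinear‖)
    obtain ⟨k, hk⟩ := (hlim.eventually_lt_const hη).exists
    refine ⟨(1 / 2) ^ k, by positivity, fun z hz => lt_of_le_of_lt ?_ hk⟩
    refine (upper x z _ (by positivity) hz.le).trans ?_
    have h1 := (h.1.near_scale (p := x) trivial k (s := (1 / 2) ^ k) (t := 1) (by positivity)
      (pow_le_one₀ (by norm_num) (by norm_num)) (by rw [← mul_pow]; norm_num)).norm_le_right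
      (one_le_pow₀ (by linarith))
    have h2 : (1 + δ) ^ k ≤ (3 / 2) ^ k := by gcongr; linarith
    calc _ ≤ (1 + 2 * δ) * ((3 / 2) ^ k * ‖(A x 1).contLinear‖ * (1 / 2) ^ k) := by
          gcongr
          exact h1.trans (by gcongr)
      _ = (1 + 2 * δ) * ‖(A x 1).contLinear‖ * ((3 / 2) ^ k * (1 / 2) ^ k) := by ring
      _ = _ := by rw [← mul_pow]; norm_num
  have ind : Topology.IsInducing F := by
    rw [Topology.isInducing_iff_nhds]
    intro x
    refine le_antisymm (cont.tendsto x).le_comap ?_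
    intro s hs
    obtain ⟨t, ht, hts⟩ := Metric.mem_nhds_iff.1 hs
    obtain ⟨i⟩ : Nonempty (Fin n) := ⟨⟨0, hn⟩⟩
    set y : Euc n := x + EuclideanSpace.single i t with hy
    have hyx : dist y x = t := by
      rw [hy, dist_eq_norm, add_sub_cancel_left]
      simp [abs_of_pos ht]
    have hyne : y ≠ x := dist_pos.1 (by rw [hyx]; exact ht)
    have hρH : 0 < ρ * H := by positivity
    -- If `z` were at distance at least `t = dist y x` from `x`, weak quasisymmetry would keep `F z`
    -- out of this ball.
    refine ⟨Metric.ball (F x) (dist (F y) (F x) / (ρ * H)),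
      Metric.ball_mem_nhds _ (div_pos (pos x y hyne) hρH), fun z hz => hts ?_⟩
    by_contra hzt
    rw [Metric.mem_ball, not_lt, ← hyx] at hzt
    have h1 := bound.2 y z x hzt
    rw [Set.mem_preimage, Metric.mem_ball, lt_div_iff₀ hρH] at hz
    linarith
  refine ⟨⟨⟨ind, inj⟩, ⟨_, bound⟩⟩, csInf_le ⟨1, fun y hy => hy.1⟩ bound⟩

/-! ### Tent functions and elementary Lipschitz bounds -/

/-- The tent function `max(0, 1 - |u|)`; its integer translates sum to `1`. -/
noncomputable def tent (u : ℝ) : ℝ := max 0 (1 - |u|)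

theorem tent_nonneg (u : ℝ) : 0 ≤ tent u := le_max_left _ _

theorem tent_le_one (u : ℝ) : tent u ≤ 1 := max_le zero_le_one (by linarith [abs_nonneg u])

theorem abs_tent_sub_tent_le (u v : ℝ) : |tent u - tent v| ≤ |u - v| := by
  refine (abs_max_sub_max_le_max _ _ _ _).trans (max_le (by simp) ?_)
  have := abs_abs_sub_abs_le v u
  rwa [sub_sub_sub_cancel_left, abs_sub_comm u v]

/-- The two integers adjacent to `u`. -/
noncomputable def adjacentInts (u : ℝ) : Finset ℤ := {⌊u⌋, ⌊u⌋ + 1}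

theorem card_adjacentInts (u : ℝ) : (adjacentInts u).card = 2 :=
  Finset.card_pair (by omega)

theorem sum_tent_adjacentInts (u : ℝ) : ∑ k ∈ adjacentInts u, tent (u - k) = 1 := by
  rw [adjacentInts, Finset.sum_pair (by omega)]
  have h1 := Int.floor_le u
  have h2 := (Int.lt_floor_add_one u).le
  push_cast
  rw [tent, tent, abs_of_nonneg (by linarith), abs_of_nonpos (by linarith),
    max_eq_right (by linarith), max_eq_right (by linarith)]
  ring

theorem tent_eq_zero_of_notMem_adjacentInts {u : ℝ} {k : ℤ} (hk : k ∉ adjacentInts u) :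
    tent (u - k) = 0 := by
  simp only [adjacentInts, Finset.mem_insert, Finset.mem_singleton, not_or] at hk
  have h1 := Int.floor_le u
  have h2 := Int.lt_floor_add_one u
  refine max_eq_left ?_
  rcases lt_or_gt_of_ne hk.1 with h | h
  · have : (k : ℝ) + 1 ≤ ⌊u⌋ := by exact_mod_cast h
    rw [abs_of_nonneg (by linarith)]
    linarith
  · have h3 : ⌊u⌋ + 2 ≤ k := by omega
    have : (⌊u⌋ : ℝ) + 2 ≤ k := by exact_mod_cast h3
    rw [abs_of_nonpos (by linarith)]
    linarith

theorem abs_sub_le_one_of_mem_adjacentInts {u : ℝ} {k : ℤ} (hk : k ∈ adjacentInts u) :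
    |u - k| ≤ 1 := by
  have h1 := Int.floor_le u
  have h2 := Int.lt_floor_add_one u
  simp only [adjacentInts, Finset.mem_insert, Finset.mem_singleton] at hk
  rw [abs_le]
  rcases hk with rfl | rfl
  · constructor <;> linarith
  · push_cast
    constructor <;> linarith

theorem abs_mul_sub_mul_le {a b a' b' : ℝ} (ha : 0 ≤ a) (ha1 : a ≤ 1) (hb : 0 ≤ b') (hb1 : b' ≤ 1) :
    |a * b - a' * b'| ≤ |a - a'| + |b - b'| := by
  have : a * b - a' * b' = (a - a') * b' + a * (b - b') := by ring
  rw [this]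
  refine (abs_add_le _ _).trans ?_
  rw [abs_mul, abs_mul, abs_of_nonneg ha, abs_of_nonneg hb]
  exact add_le_add (mul_le_of_le_one_right (abs_nonneg _) hb1)
    (mul_le_of_le_one_left (abs_nonneg _) ha1)

theorem abs_prod_sub_prod_le {ι : Type*} (s : Finset ι) {f g : ι → ℝ} (hf : ∀ i, 0 ≤ f i)
    (hf1 : ∀ i, f i ≤ 1) (hg : ∀ i, 0 ≤ g i) (hg1 : ∀ i, g i ≤ 1) :
    |∏ i ∈ s, f i - ∏ i ∈ s, g i| ≤ ∑ i ∈ s, |f i - g i| := by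
  classical
  induction s using Finset.induction_on with
  | empty => simp
  | insert i s hi ih =>
    rw [Finset.prod_insert hi, Finset.prod_insert hi, Finset.sum_insert hi]
    refine (abs_mul_sub_mul_le (hf i) (hf1 i) (Finset.prod_nonneg fun j _ => hg j)
      (Finset.prod_le_one (fun j _ => hg j) fun j _ => hg1 j)).trans ?_
    gcongr

/-- Apply `log t ≤ t - 1` to both `b / a` and `a / b`; replacing the denominator `b` by `a` costs
the factor 2. -/
theorem abs_log_sub_log_le {a b : ℝ} (ha : 0 < a) (hb : a / 2 ≤ b) :
    |Real.log b - Real.log a| ≤ 2 * |b - a| / a := by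
  have hb0 : 0 < b := by linarith
  have h1 := Real.log_le_sub_one_of_pos (div_pos hb0 ha)
  have h2 := Real.log_le_sub_one_of_pos (div_pos ha hb0)
  rw [Real.log_div hb0.ne' ha.ne'] at h1
  rw [Real.log_div ha.ne' hb0.ne'] at h2
  have h3 : b / a - 1 ≤ 2 * |b - a| / a := by
    rw [div_sub_one ha.ne']
    gcongr
    linarith [le_abs_self (b - a), abs_nonneg (b - a)]
  have h4 : a / b - 1 ≤ 2 * |b - a| / a := by
    rw [div_sub_one hb0.ne', div_le_div_iff₀ hb0 ha]
    have := neg_abs_le (b - a)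
    nlinarith [abs_nonneg (b - a)]
  rw [abs_le]
  constructor <;> linarith

theorem EuclideanSpace.norm_le_card_mul {n : ℕ} {v : Euc n} {c : ℝ} (hc : 0 ≤ c)
    (hv : ∀ j, |v j| ≤ c) : ‖v‖ ≤ n * c := by
  refine (pow_le_pow_iff_left₀ (norm_nonneg _) (by positivity) two_ne_zero).1 ?_
  rw [EuclideanSpace.real_norm_sq_eq]
  calc ∑ j, v j ^ 2 ≤ ∑ _j : Fin n, c ^ 2 := by
        refine Finset.sum_le_sum fun j _ => ?_
        rw [← sq_abs]
        exact pow_le_pow_left₀ (abs_nonneg _) (hv j) 2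
    _ = n * c ^ 2 := by simp
    _ ≤ (n : ℝ) ^ 2 * c ^ 2 := by
        gcongr
        exact_mod_cast Nat.le_self_pow two_ne_zero n
    _ = _ := by ring

/-! ### A multiscale partition of unity -/

/-- Multiscale tent function: `i = ⟨k, m⟩` is the lattice point `eᵏ m` at scale `eᵏ`, and the
function is supported where `d` is comparable to `eᵏ`, at distance `≲ eᵏ` from that point. -/
noncomputable def scaleTent {n : ℕ} (d : Euc n → ℝ) (i : Σ _ : ℤ, Fin n → ℤ) (x : Euc n) : ℝ :=
  tent (Real.log (d x) - i.1) * ∏ j, tent (x j * Real.exp (-i.1) - i.2 j)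

/-- The indices of the multiscale tent functions that may be nonzero at `x`. -/
noncomputable def scaleSupport {n : ℕ} (d : Euc n → ℝ) (x : Euc n) :
    Finset (Σ _ : ℤ, Fin n → ℤ) :=
  (adjacentInts (Real.log (d x))).sigma fun k =>
    Fintype.piFinset fun j => adjacentInts (x j * Real.exp (-k))

/-- The lattice point `eᵏ m` of the index `⟨k, m⟩`. -/
noncomputable def scaleCenter {n : ℕ} (i : Σ _ : ℤ, Fin n → ℤ) : Euc n :=
  WithLp.toLp 2 fun j => i.2 j * Real.exp i.1

section ScaleTent

variable {n : ℕ} {d : Euc n → ℝ} {x y : Euc n} {i : Σ _ : ℤ, Fin n → ℤ}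

theorem scaleTent_nonneg : 0 ≤ scaleTent d i x :=
  mul_nonneg (tent_nonneg _) (Finset.prod_nonneg fun _ _ => tent_nonneg _)

theorem scaleTent_eq_zero (hi : i ∉ scaleSupport d x) : scaleTent d i x = 0 := by
  obtain ⟨k, m⟩ := i
  simp only [scaleSupport, Finset.mem_sigma, Fintype.mem_piFinset, not_and_or, not_forall] at hi
  rcases hi with h | ⟨j, hj⟩
  · simp [scaleTent, tent_eq_zero_of_notMem_adjacentInts h]
  · rw [scaleTent, Finset.prod_eq_zero (Finset.mem_univ j)
      (tent_eq_zero_of_notMem_adjacentInts hj), mul_zero]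

/-- At each scale the sum over the lattice factors into one-dimensional tent sums, each equal to 1;
what remains is the tent sum in `log (d x)`. -/
theorem sum_scaleTent : ∑ i ∈ scaleSupport d x, scaleTent d i x = 1 := by
  rw [scaleSupport, Finset.sum_sigma, ← sum_tent_adjacentInts (Real.log (d x))]
  refine Finset.sum_congr rfl fun k _ => ?_
  simp only [scaleTent]
  rw [← Finset.mul_sum,
    ← Finset.prod_univ_sum (fun j => adjacentInts (x j * Real.exp (-k)))
      (fun j m => tent (x j * Real.exp (-k) - m))]
  simp [sum_tent_adjacentInts]

theorem card_scaleSupport : (scaleSupport d x).card = 2 * 2 ^ n := by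
  simp [scaleSupport, card_adjacentInts]

theorem exp_le_of_mem_scaleSupport (hx : 0 < d x) (hi : i ∈ scaleSupport d x) :
    Real.exp i.1 ≤ 3 * d x ∧ d x ≤ 3 * Real.exp i.1 := by
  have h := abs_le.1 (abs_sub_le_one_of_mem_adjacentInts (Finset.mem_sigma.1 hi).1)
  have he : Real.exp 1 ≤ 3 := by linarith [Real.exp_one_lt_d9]
  constructor
  · calc Real.exp i.1 ≤ Real.exp (1 + Real.log (d x)) := Real.exp_le_exp.2 (by linarith)
      _ = Real.exp 1 * d x := by rw [Real.exp_add, Real.exp_log hx]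
      _ ≤ _ := by gcongr
  · calc d x = Real.exp (Real.log (d x)) := (Real.exp_log hx).symm
      _ ≤ Real.exp (1 + i.1) := Real.exp_le_exp.2 (by linarith)
      _ = Real.exp 1 * Real.exp i.1 := Real.exp_add _ _
      _ ≤ _ := by gcongr

theorem dist_scaleCenter_le (hi : i ∈ scaleSupport d x) :
    dist x (scaleCenter i) ≤ n * Real.exp i.1 := by
  rw [dist_eq_norm]
  refine EuclideanSpace.norm_le_card_mul (Real.exp_pos _).le fun j => ?_
  have h := abs_sub_le_one_of_mem_adjacentInts
    (Fintype.mem_piFinset.1 (Finset.mem_sigma.1 hi).2 j)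
  have : (x - scaleCenter i) j = (x j * Real.exp (-i.1) - i.2 j) * Real.exp i.1 := by
    simp only [scaleCenter, PiLp.sub_apply]
    rw [sub_mul, mul_assoc, ← Real.exp_add]
    simp
  rw [this, abs_mul, abs_of_pos (Real.exp_pos _)]
  exact mul_le_of_le_one_left (Real.exp_pos _).le h

/-- The scale factor is Lipschitz through `log d`, and each of the `n` coordinate factors has slope
`exp (-k) ≤ 6 / d x`. -/
theorem abs_scaleTent_sub_le (hx : 0 < d x) (hxy : |d y - d x| ≤ dist y x)
    (hy : dist y x ≤ d x / 2) (hi : d x ≤ 6 * Real.exp i.1) :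
    |scaleTent d i y - scaleTent d i x| ≤ (2 + 6 * n) * (dist y x / d x) := by
  have hdy : d x / 2 ≤ d y := by linarith [(abs_le.1 hxy).1]
  refine (abs_mul_sub_mul_le (tent_nonneg _) (tent_le_one _)
    (Finset.prod_nonneg fun _ _ => tent_nonneg _)
    (Finset.prod_le_one (fun _ _ => tent_nonneg _) fun _ _ => tent_le_one _)).trans ?_
  rw [add_mul]
  refine add_le_add ?_ ?_
  · refine (abs_tent_sub_tent_le _ _).trans ?_
    rw [sub_sub_sub_cancel_right]
    refine (abs_log_sub_log_le hx hdy).trans ?_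
    rw [mul_div_assoc]
    gcongr
  · refine (abs_prod_sub_prod_le _ (fun _ => tent_nonneg _) (fun _ => tent_le_one _)
      (fun _ => tent_nonneg _) (fun _ => tent_le_one _)).trans ?_
    calc _ ≤ ∑ _j : Fin n, 6 * (dist y x / d x) := by
          refine Finset.sum_le_sum fun j _ => (abs_tent_sub_tent_le _ _).trans ?_
          rw [sub_sub_sub_cancel_right, ← sub_mul, abs_mul, Real.exp_neg, abs_inv,
            abs_of_pos (Real.exp_pos _)]
          have h1 : |y j - x j| ≤ dist y x := by
            rw [dist_eq_norm]
            exact PiLp.norm_apply_le (y - x) j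
          have h2 : (Real.exp i.1)⁻¹ ≤ 6 / d x := by
            rw [inv_eq_one_div, div_le_div_iff₀ (Real.exp_pos _) hx]
            linarith
          calc _ ≤ dist y x * (6 / d x) := by gcongr
            _ = _ := by ring
      _ = _ := by
          rw [Finset.sum_const, Finset.card_univ, Fintype.card_fin, nsmul_eq_mul]
          ring

theorem exp_le_of_mem_union (hx : 0 < d x) (hxy : |d y - d x| ≤ dist y x)
    (hy : dist y x ≤ d x / 2) (hi : i ∈ scaleSupport d x ∪ scaleSupport d y) :
    Real.exp i.1 ≤ 6 * d x ∧ d x ≤ 6 * Real.exp i.1 := by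
  have hd := abs_le.1 hxy
  rcases Finset.mem_union.1 hi with h | h
  · have := exp_le_of_mem_scaleSupport hx h
    constructor <;> linarith
  · have := exp_le_of_mem_scaleSupport (by linarith) h
    constructor <;> linarith

theorem sum_abs_scaleTent_sub_le (hx : 0 < d x) (hxy : |d y - d x| ≤ dist y x)
    (hy : dist y x ≤ d x / 2) :
    ∑ i ∈ scaleSupport d x ∪ scaleSupport d y, |scaleTent d i y - scaleTent d i x| ≤
      4 * 2 ^ n * (2 + 6 * n) * (dist y x / d x) := by
  -- Overlap is bounded independently of the points: two supports of `2 * 2 ^ n` indices each.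
  have hc : ((scaleSupport d x ∪ scaleSupport d y).card : ℝ) ≤ 4 * 2 ^ n := by
    have := Finset.card_union_le (scaleSupport d x) (scaleSupport d y)
    rw [card_scaleSupport, card_scaleSupport] at this
    have h2 : (scaleSupport d x ∪ scaleSupport d y).card ≤ 4 * 2 ^ n := by omega
    exact_mod_cast h2
  refine (Finset.sum_le_card_nsmul _ _ _ fun i hi =>
    abs_scaleTent_sub_le hx hxy hy (exp_le_of_mem_union hx hxy hy hi).2).trans ?_
  rw [nsmul_eq_mul, mul_assoc (4 * 2 ^ n : ℝ)]
  gcongr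

end ScaleTent

/-! ### The extension and its estimates -/

/-- Blend of the affine maps `A_{π(c),σ}` over the multiscale tent functions off `E`, equal to `f`
on `E`. -/
noncomputable def tentExtension {n N : ℕ} (E : Set (Euc n)) (f : Euc n → Euc N)
    (A : Euc n → ℝ → (Euc n →ᴬ[ℝ] Euc N)) (π : Euc n → Euc n) (x : Euc n) : Euc N :=
  open Classical in
  if x ∈ E then f x else
    ∑ i ∈ scaleSupport (Metric.infDist · E) x,
      scaleTent (Metric.infDist · E) i x • A (π (scaleCenter i)) (Real.exp i.1) x

/-- The affine maps of the extended family: those of `A` over `E`, and off `E` the linear part at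
the nearest point and the scale `max r (dist x E)`, translated to agree with `F` at `x`. -/
noncomputable def extendedFamily {n N : ℕ} (E : Set (Euc n)) (F : Euc n → Euc N)
    (A : Euc n → ℝ → (Euc n →ᴬ[ℝ] Euc N)) (π : Euc n → Euc n) (x : Euc n) (r : ℝ) :
    Euc n →ᴬ[ℝ] Euc N :=
  open Classical in
  if x ∈ E then A x r else
    (A (π x) (max r (Metric.infDist x E))).contLinear.toContinuousAffineMap +
      ContinuousAffineMap.const ℝ (Euc n)
        (F x - (A (π x) (max r (Metric.infDist x E))).contLinear x)

/-- Bound for the error of the blend against a member of the family at comparable scale. -/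
noncomputable def blendConst (n : ℕ) : ℝ := (2 * n + 11) * (1 + 2 ^ (n + 7)) * 2 ^ (n + 5)

/-- Bound for the Lipschitz constant, in units of the distance to `E`, of the tent partition. -/
noncomputable def tentConst (n : ℕ) : ℝ := 4 * 2 ^ n * (2 + 6 * n)

theorem natCast_add_one_le_two_pow (n : ℕ) : (n : ℝ) + 1 ≤ 2 ^ n := by
  exact_mod_cast Nat.lt_two_pow_self

/-- Provides one dyadic factor dominating every distance ratio in the two blend estimates; the
largest is `3 / 2 + 6 * (2 * n + 5)`. -/
theorem le_two_pow_add_five (n : ℕ) : 12 * (n : ℝ) + 32 ≤ 2 ^ (n + 5) := by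
  have := natCast_add_one_le_two_pow n
  rw [pow_add]
  have : (0 : ℝ) ≤ n := n.cast_nonneg
  norm_num
  linarith

theorem two_pow_nine_le_blendConst (n : ℕ) : 2 ^ 9 ≤ blendConst n := by
  have h1 := natCast_add_one_le_two_pow n
  have h0 : (0 : ℝ) ≤ n := n.cast_nonneg
  have h2 : (2 : ℝ) ^ 5 ≤ 2 ^ (n + 5) := pow_le_pow_right₀ (by norm_num) (by omega)
  have h3 : (2 : ℝ) ^ 7 ≤ 2 ^ (n + 7) := pow_le_pow_right₀ (by norm_num) (by omega)
  calc (2 : ℝ) ^ 9 ≤ 11 * (1 + 2 ^ 7) * 2 ^ 5 := by norm_num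
    _ ≤ (2 * (n : ℝ) + 11) * (1 + 2 ^ (n + 7)) * 2 ^ (n + 5) := by gcongr; linarith

theorem tentConst_nonneg (n : ℕ) : 0 ≤ tentConst n := by
  unfold tentConst
  positivity

section Extension

variable {n N : ℕ} {ε : ℝ} {E : Set (Euc n)} {f : Euc n → Euc N}
  {A : Euc n → ℝ → (Euc n →ᴬ[ℝ] Euc N)} {π : Euc n → Euc n}

theorem abs_infDist_sub_infDist_le (x y : Euc n) :
    |Metric.infDist y E - Metric.infDist x E| ≤ dist y x := by
  have h1 := Metric.infDist_le_infDist_add_dist (s := E) (x := y) (y := x)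
  have h2 := Metric.infDist_le_infDist_add_dist (s := E) (x := x) (y := y)
  rw [dist_comm x y] at h2
  rw [abs_le]
  constructor <;> linarith

theorem infDist_pos_of_notMem (hE : IsClosed E) (hne : E.Nonempty) {x : Euc n} (hx : x ∉ E) :
    0 < Metric.infDist x E :=
  (hE.notMem_iff_infDist_pos hne).1 hx

theorem tentExtension_of_mem {x : Euc n} (hx : x ∈ E) : tentExtension E f A π x = f x := by
  simp [tentExtension, hx]

theorem tentExtension_eq_sum {x : Euc n} (hx : x ∉ E) {S : Finset (Σ _ : ℤ, Fin n → ℤ)}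
    (hS : scaleSupport (Metric.infDist · E) x ⊆ S) :
    tentExtension E f A π x = ∑ i ∈ S, scaleTent (Metric.infDist · E) i x •
      A (π (scaleCenter i)) (Real.exp i.1) x := by
  rw [tentExtension, if_neg hx]
  refine Finset.sum_subset hS fun i _ hi => ?_
  rw [scaleTent_eq_zero hi, zero_smul]

theorem sum_scaleTent_eq_one {d : Euc n → ℝ} {x : Euc n} {S : Finset (Σ _ : ℤ, Fin n → ℤ)}
    (hS : scaleSupport d x ⊆ S) : ∑ i ∈ S, scaleTent d i x = 1 := by
  rw [← sum_scaleTent (d := d) (x := x)]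
  exact (Finset.sum_subset hS fun i _ hi => scaleTent_eq_zero hi).symm

/-- The centre is within `n * eᵏ` of `z`, hence within `(n + 3) * eᵏ` of `E`. -/
theorem dist_nearest_scaleCenter_le (hE : IsClosed E) (hne : E.Nonempty)
    (hπ : ∀ x, Metric.infDist x E = dist x (π x)) {z : Euc n} (hz : z ∉ E)
    {i : Σ _ : ℤ, Fin n → ℤ} (hi : i ∈ scaleSupport (Metric.infDist · E) z) :
    dist z (π (scaleCenter i)) ≤ (2 * n + 3) * Real.exp i.1 := by
  have h1 := dist_scaleCenter_le hi
  have h2 := (abs_le.1 (abs_infDist_sub_infDist_le (E := E) z (scaleCenter i))).2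
  have h3 := (exp_le_of_mem_scaleSupport (infDist_pos_of_notMem hE hne hz) hi).2
  have h4 := dist_triangle z (scaleCenter i) (π (scaleCenter i))
  rw [← hπ] at h4
  rw [dist_comm (scaleCenter i) z] at h2
  linarith

/-- Off `E` the difference is a convex combination of the values at `z` of the differences between
the blended maps and `A p r`. Their scales may be far below `r`, which `norm_apply_sub_apply_le`
allows. -/
theorem IsAlmostAffine.norm_tentExtension_sub_le (h : IsAlmostAffine ε f E A) (hε1 : ε ≤ 1)
    (hE : IsClosed E) (hπE : ∀ x, π x ∈ E) (hπ : ∀ x, Metric.infDist x E = dist x (π x))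
    {p z : Euc n} {r : ℝ} (hp : p ∈ E) (hr : 0 < r) (hz : dist z p ≤ r) :
    ‖tentExtension E f A π z - A p r z‖ ≤ blendConst n * (ε * ‖(A p r).contLinear‖ * r) := by
  have hε := h.1.1
  by_cases hzE : z ∈ E
  · rw [tentExtension_of_mem hzE]
    refine (h.2 p hp r hr z ⟨hzE, hz⟩).trans (le_mul_of_one_le_left (by positivity) ?_)
    exact le_trans (by norm_num) (two_pow_nine_le_blendConst n)
  · have hne : E.Nonempty := ⟨p, hp⟩
    set d : Euc n → ℝ := (Metric.infDist · E) with hd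
    have hd0 : 0 < d z := infDist_pos_of_notMem hE hne hzE
    have hdr : d z ≤ r := (Metric.infDist_le_dist_of_mem hp).trans hz
    have hk := le_two_pow_add_five n
    have hn0 : (0 : ℝ) ≤ n := n.cast_nonneg
    rw [tentExtension_eq_sum hzE (Finset.Subset.refl _)]
    have hsum := sum_scaleTent (d := d) (x := z)
    have e : ∑ i ∈ scaleSupport d z, scaleTent d i z • A (π (scaleCenter i)) (Real.exp i.1) z -
        A p r z = ∑ i ∈ scaleSupport d z,
          scaleTent d i z • (A (π (scaleCenter i)) (Real.exp i.1) z - A p r z) := by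
      simp only [smul_sub, Finset.sum_sub_distrib]
      rw [← Finset.sum_smul, hsum, one_smul]
    rw [e]
    calc _ ≤ ∑ i ∈ scaleSupport d z,
          scaleTent d i z * (blendConst n * (ε * ‖(A p r).contLinear‖ * r)) := by
          refine (norm_sum_le _ _).trans (Finset.sum_le_sum fun i hi => ?_)
          rw [norm_smul, Real.norm_of_nonneg scaleTent_nonneg]
          refine mul_le_mul_of_nonneg_left ?_ scaleTent_nonneg
          have hq := dist_nearest_scaleCenter_le hE hne hπ hzE hi
          have hσ := exp_le_of_mem_scaleSupport hd0 hi
          have hσ0 := Real.exp_pos i.1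
          have hpq : dist p (π (scaleCenter i)) ≤ 2 ^ (n + 5) * r := by
            have h1 := dist_triangle_left p (π (scaleCenter i)) z
            have h2 : (2 * n + 3) * Real.exp i.1 ≤ (2 * n + 3) * (3 * r) := by
              gcongr
              linarith
            nlinarith
          -- With these parameters the factors `Λ + 6`, `1 + 2 ^ (k + 2)` and `T / r` multiply to
          -- `blendConst n`.
          refine (h.norm_apply_sub_apply_le hε1 hp (hπE _) (k := n + 5) (T := 2 ^ (n + 5) * r)
            (Λ := 2 * n + 5) hr hσ0 (by positivity) hpq (by nlinarith) (by nlinarith) le_rfl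
            (by linarith)).trans (le_of_eq ?_)
          unfold blendConst
          ring
      _ = _ := by rw [← Finset.sum_mul, hsum, one_mul]

theorem IsAlmostAffine.norm_tentExtension_sub_sub_le (h : IsAlmostAffine ε f E A) (hε1 : ε ≤ 1)
    (hE : IsClosed E) (hπE : ∀ x, π x ∈ E) (hπ : ∀ x, Metric.infDist x E = dist x (π x))
    {x y : Euc n} (hx : x ∉ E) (hxy : dist y x ≤ Metric.infDist x E / 2) :
    ‖tentExtension E f A π y - tentExtension E f A π x -
        (A (π x) (Metric.infDist x E)).contLinear (y - x)‖ ≤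
      (tentConst n + 6) * blendConst n *
        (ε * ‖(A (π x) (Metric.infDist x E)).contLinear‖ * dist y x) := by
  have hε := h.1.1
  have hne : E.Nonempty := ⟨_, hπE x⟩
  set d : Euc n → ℝ := (Metric.infDist · E) with hd
  change dist y x ≤ d x / 2 at hxy
  have hdx : 0 < d x := infDist_pos_of_notMem hE hne hx
  have hlip : |d y - d x| ≤ dist y x := abs_infDist_sub_infDist_le x y
  have hdy : 0 < d y := by linarith [(abs_le.1 hlip).1]
  have hy : y ∉ E := fun hy => hdy.ne' (Metric.infDist_zero_of_mem hy)
  have hk := le_two_pow_add_five n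
  have hn0 : (0 : ℝ) ≤ n := n.cast_nonneg
  have hC := two_pow_nine_le_blendConst n
  set p := π x with hp
  set S := scaleSupport d x ∪ scaleSupport d y with hS
  change ‖_ - _ - (A p (d x)).contLinear (y - x)‖ ≤
    _ * (ε * ‖(A p (d x)).contLinear‖ * dist y x)
  set a := ‖(A p (d x)).contLinear‖ with ha
  have ha0 : 0 ≤ a := norm_nonneg _
  set B : (Σ _ : ℤ, Fin n → ℤ) → (Euc n →ᴬ[ℝ] Euc N) :=
    fun i => A (π (scaleCenter i)) (Real.exp i.1) with hB
  have hFx : tentExtension E f A π x = ∑ i ∈ S, scaleTent d i x • B i x :=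
    tentExtension_eq_sum hx Finset.subset_union_left
  have hFy : tentExtension E f A π y = ∑ i ∈ S, scaleTent d i y • B i y :=
    tentExtension_eq_sum hy Finset.subset_union_right
  have hsx : ∑ i ∈ S, scaleTent d i x = 1 := sum_scaleTent_eq_one Finset.subset_union_left
  have hsy : ∑ i ∈ S, scaleTent d i y = 1 := sum_scaleTent_eq_one Finset.subset_union_right
  -- The weight increments sum to zero, so `A p (d x) y` may be subtracted inside the first sum. Its
  -- terms of size `O(ε a d x)` then meet weight changes of size `O(dist y x / d x)`, leaving an
  -- error proportional to `dist y x`.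
  have key : tentExtension E f A π y - tentExtension E f A π x -
      (A p (d x)).contLinear (y - x) =
      ∑ i ∈ S, (scaleTent d i y - scaleTent d i x) • (B i y - A p (d x) y) +
      ∑ i ∈ S, scaleTent d i x • ((B i).contLinear - (A p (d x)).contLinear) (y - x) := by
    have i1 : ∀ i, (B i).contLinear (y - x) = B i y - B i x := fun i =>
      (B i).contLinear_map_vsub y x
    rw [hFx, hFy]
    simp only [sub_apply, smul_sub, sub_smul, Finset.sum_sub_distrib, i1]
    simp only [← Finset.sum_smul, hsx, hsy, one_smul]
    abel
  have geom : ∀ i ∈ S, Real.exp i.1 ≤ 2 ^ (n + 5) * d x ∧ d x ≤ 6 * Real.exp i.1 ∧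
      dist y (π (scaleCenter i)) ≤ (2 * n + 5) * Real.exp i.1 ∧
      dist p (π (scaleCenter i)) ≤ 2 ^ (n + 5) * d x := by
    intro i hi
    have hσ := exp_le_of_mem_union hdx hlip hxy hi
    have hσ0 := Real.exp_pos i.1
    have hyq : dist y (π (scaleCenter i)) ≤ (2 * n + 5) * Real.exp i.1 := by
      rcases Finset.mem_union.1 hi with hi | hi
      · have h1 := dist_nearest_scaleCenter_le hE hne hπ hx hi
        have h2 := dist_triangle y x (π (scaleCenter i))
        have h3 := exp_le_of_mem_scaleSupport hdx hi
        linarith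
      · have h1 := dist_nearest_scaleCenter_le hE hne hπ hy hi
        linarith
    refine ⟨by nlinarith, hσ.2, hyq, ?_⟩
    have h1 : dist x p = d x := (hπ x).symm
    have h2 := dist_triangle4 p x y (π (scaleCenter i))
    rw [dist_comm p x, dist_comm x y] at h2
    have h3 : (2 * n + 5) * Real.exp i.1 ≤ (2 * n + 5) * (6 * d x) := by
      gcongr
      exact hσ.1
    nlinarith
  have hdT : d x ≤ 2 ^ (n + 5) * d x := by nlinarith
  have est1 : ∀ i ∈ S, ‖B i y - A p (d x) y‖ ≤ blendConst n * (ε * a * d x) := by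
    intro i hi
    obtain ⟨g1, -, g3, g4⟩ := geom i hi
    refine (h.norm_apply_sub_apply_le hε1 (hπE x) (hπE _) (k := n + 5) (T := 2 ^ (n + 5) * d x)
      (Λ := 2 * n + 5) hdx (Real.exp_pos _) (by positivity) g4 hdT g1 le_rfl g3).trans
      (le_of_eq ?_)
    unfold blendConst
    ring
  have est2 : ∀ i ∈ S, ‖(B i).contLinear - (A p (d x)).contLinear‖ ≤
      6 * (blendConst n * (ε * a)) := by
    intro i hi
    obtain ⟨g1, g2, -, g4⟩ := geom i hi
    have hσ0 := Real.exp_pos i.1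
    have h1 := h.1.norm_sub_mul_scale_le hε1 (hπE x) (hπE (scaleCenter i)) (k := n + 5) hdx hσ0 g4
      hdT g1 le_rfl
    have h2 : (2 : ℝ) ^ (n + 7) * 2 ^ (n + 5) ≤ blendConst n := by
      unfold blendConst
      gcongr
      nlinarith [pow_pos (two_pos : (0 : ℝ) < 2) (n + 7)]
    refine le_of_mul_le_mul_right ?_ hσ0
    calc _ ≤ _ := h1
      _ = (2 ^ (n + 7) * 2 ^ (n + 5)) * (ε * a) * d x := by ring
      _ ≤ blendConst n * (ε * a) * (6 * Real.exp i.1) := by gcongr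
      _ = _ := by ring
  rw [key]
  have b1 : ‖∑ i ∈ S, (scaleTent d i y - scaleTent d i x) • (B i y - A p (d x) y)‖ ≤
      tentConst n * blendConst n * (ε * a * dist y x) := by
    calc _ ≤ ∑ i ∈ S, |scaleTent d i y - scaleTent d i x| * (blendConst n * (ε * a * d x)) := by
          refine (norm_sum_le _ _).trans (Finset.sum_le_sum fun i hi => ?_)
          rw [norm_smul, Real.norm_eq_abs]
          exact mul_le_mul_of_nonneg_left (est1 i hi) (abs_nonneg _)
      _ ≤ (tentConst n * (dist y x / d x)) * (blendConst n * (ε * a * d x)) := by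
          rw [← Finset.sum_mul]
          refine mul_le_mul_of_nonneg_right (sum_abs_scaleTent_sub_le hdx hlip hxy) ?_
          have : 0 ≤ blendConst n := le_trans (by norm_num) hC
          positivity
      _ = _ := by field_simp
  have b2 : ‖∑ i ∈ S, scaleTent d i x • ((B i).contLinear - (A p (d x)).contLinear) (y - x)‖ ≤
      6 * blendConst n * (ε * a * dist y x) := by
    calc _ ≤ ∑ i ∈ S, scaleTent d i x * (6 * (blendConst n * (ε * a)) * dist y x) := by
          refine (norm_sum_le _ _).trans (Finset.sum_le_sum fun i hi => ?_)
          rw [norm_smul, Real.norm_of_nonneg scaleTent_nonneg]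
          refine mul_le_mul_of_nonneg_left ?_ scaleTent_nonneg
          refine (ContinuousLinearMap.le_opNorm _ _).trans ?_
          have := est2 i hi
          rw [← dist_eq_norm y x]
          exact mul_le_mul_of_nonneg_right this dist_nonneg
      _ = _ := by
          rw [← Finset.sum_mul, hsx]
          ring
  refine (norm_add_le _ _).trans ((add_le_add b1 b2).trans (le_of_eq ?_))
  ring

/-- On `E` the distance is 0 and `π x = x`, so one formula covers both cases of the definition. -/
theorem extendedFamily_contLinear {F : Euc n → Euc N}
    (hπ : ∀ x, Metric.infDist x E = dist x (π x)) (x : Euc n) {r : ℝ} (hr : 0 < r) :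
    (extendedFamily E F A π x r).contLinear =
      (A (π x) (max r (Metric.infDist x E))).contLinear := by
  unfold extendedFamily
  split_ifs with hx
  · have h0 := Metric.infDist_zero_of_mem hx
    have : π x = x := (dist_eq_zero.1 ((hπ x).symm.trans h0)).symm
    rw [h0, this, max_eq_left hr.le]
  · simp

theorem extendedFamily_apply {F : Euc n → Euc N} {x : Euc n} (hx : x ∉ E) (r : ℝ) (z : Euc n) :
    extendedFamily E F A π x r z =
      F x + (A (π x) (max r (Metric.infDist x E))).contLinear (z - x) := by
  simp only [extendedFamily, if_neg hx, ContinuousAffineMap.add_apply, map_sub]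
  simp
  abel

theorem IsCompatibleFamily.extendedFamily (h : IsCompatibleFamily ε E A) (hε1 : ε ≤ 1)
    {F : Euc n → Euc N} (hπE : ∀ x, π x ∈ E) (hπ : ∀ x, Metric.infDist x E = dist x (π x)) :
    IsCompatibleFamily (2 ^ 9 * ε) Set.univ (extendedFamily E F A π) := by
  have hε := h.1
  refine ⟨by positivity, fun x _ y _ r hr s hs hxy h1 h2 => ?_⟩
  rw [extendedFamily_contLinear hπ x hr, extendedFamily_contLinear hπ y hs]
  rw [div_le_iff₀ hs] at h2
  rw [div_le_div_iff₀ two_pos hs] at h1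
  have hl := abs_le.1 (abs_infDist_sub_infDist_le (E := E) x y)
  rw [dist_comm y x] at hl
  have hx0 : 0 ≤ Metric.infDist x E := Metric.infDist_nonneg
  have hy0 : 0 ≤ Metric.infDist y E := Metric.infDist_nonneg
  set r' := max r (Metric.infDist x E) with hr'
  set s' := max s (Metric.infDist y E) with hs'
  have k1 : r ≤ r' := le_max_left _ _
  have k2 : Metric.infDist x E ≤ r' := le_max_right _ _
  have k3 : s ≤ s' := le_max_left _ _
  have k4 : Metric.infDist y E ≤ s' := le_max_right _ _
  have m1 : dist x y ≤ 2 * r := hxy.trans (max_le (by linarith) (by linarith))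
  have m2 : dist x y ≤ 2 * s := hxy.trans (max_le (by linarith) (by linarith))
  have l1 : s' ≤ 3 * r' := max_le (by linarith) (by linarith)
  have l2 : r' ≤ 3 * s' := max_le (by linarith) (by linarith)
  have hpq : dist (π x) (π y) ≤ 4 * max r' s' := by
    have := dist_triangle4 (π x) x y (π y)
    rw [dist_comm (π x) x, ← hπ, ← hπ] at this
    have n1 := le_max_left r' s'
    have n2 := le_max_right r' s'
    linarith
  have hr0 : 0 < r' := hr.trans_le k1
  have hs0 : 0 < s' := hs.trans_le k3
  have hM : max r' s' ≤ 3 * r' := max_le (by linarith) l1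
  have hM' : max r' s' ≤ 3 * s' := max_le l2 (by linarith)
  -- The common scale `4 * max r' s'` is at most 12 times either scale, hence `2 ^ 4`; the exponent
  -- `4 + 1 + 4` yields the constant `2 ^ 9`.
  have near := h.near_of_common_scale (hπE x) (hπE y) (j := 4) (k := 4) hr0 hs0 hpq
    (by linarith [le_max_left r' s']) (by linarith [le_max_right r' s']) (by linarith)
    (by linarith)
  refine le_trans near (mul_le_mul_of_nonneg_right ?_
    (le_min (norm_nonneg _) (norm_nonneg _)))
  have := one_add_pow_le hε.le hε1 9
  norm_num at this ⊢
  linarith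

theorem IsAlmostAffine.extension (h : IsAlmostAffine ε f E A) (hε1 : ε ≤ 1)
    (hE : IsClosed E) (hπE : ∀ x, π x ∈ E) (hπ : ∀ x, Metric.infDist x E = dist x (π x)) :
    IsAlmostAffine (18 * ((tentConst n + 6) * blendConst n) * ε) (tentExtension E f A π) Set.univ
      (extendedFamily E (tentExtension E f A π) A π) := by
  have hε := h.1.1
  have hC := two_pow_nine_le_blendConst n
  have hC0 : 0 < blendConst n := lt_of_lt_of_le (by norm_num) hC
  have hP := tentConst_nonneg n
  set C := blendConst n
  set C' := (tentConst n + 6) * C with hC'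
  have hCC' : C ≤ C' := le_mul_of_one_le_left hC0.le (by linarith)
  set F := tentExtension E f A π with hF
  have hcomp := h.1.extendedFamily (F := F) hε1 hπE hπ
  have hle : 2 ^ 9 * ε ≤ 18 * C' * ε := by
    gcongr
    linarith
  have hC'0 : 0 < C' := hC0.trans_le hCC'
  refine ⟨⟨by positivity, fun x hx y hy r hr s hs h1 h2 h3 =>
    (hcomp.2 x hx y hy r hr s hs h1 h2 h3).trans (by gcongr)⟩, fun x _ r hr z hz => ?_⟩
  have hzx : dist z x ≤ r := hz.2
  by_cases hx : x ∈ E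
  · have e : extendedFamily E F A π x r = A x r := by simp [extendedFamily, hx]
    rw [e]
    have h1 := h.norm_tentExtension_sub_le hε1 hE hπE hπ hx hr hzx
    have h2 : 0 ≤ ε * ‖(A x r).contLinear‖ * r := by positivity
    calc _ ≤ C * (ε * ‖(A x r).contLinear‖ * r) := h1
      _ ≤ (18 * C') * (ε * ‖(A x r).contLinear‖ * r) := by gcongr; linarith
      _ = _ := by ring
  · rw [extendedFamily_contLinear hπ x hr, extendedFamily_apply hx, ← sub_sub]
    have hd : 0 < Metric.infDist x E := infDist_pos_of_notMem hE ⟨_, hπE x⟩ hx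
    by_cases hrd : r ≤ Metric.infDist x E / 2
    · rw [max_eq_right (by linarith)]
      have h1 := h.norm_tentExtension_sub_sub_le hε1 hE hπE hπ hx (hzx.trans hrd)
      set a := ‖(A (π x) (Metric.infDist x E)).contLinear‖
      calc _ ≤ C' * (ε * a * dist z x) := h1
        _ ≤ (18 * C') * (ε * a * r) := by gcongr; linarith
        _ = _ := by ring
    -- Here `r` is comparable to `R`, so both `x` and `z` are compared with `A p (2 * R)` on a ball
    -- centred at the nearest point `p`.
    · push Not at hrd
      set R := max r (Metric.infDist x E) with hR
      have hrR : r ≤ R := le_max_left _ _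
      have hdR : Metric.infDist x E ≤ R := le_max_right _ _
      have hR2 : R ≤ 2 * r := max_le (by linarith) (by linarith)
      have hR0 : 0 < R := hr.trans_le hrR
      set p := π x
      have hxp : dist x p ≤ R := (hπ x).symm.le.trans hdR
      have hzp : dist z p ≤ 2 * R := by linarith [dist_triangle z x p]
      have h1 := h.norm_tentExtension_sub_le hε1 hE hπE hπ (hπE x) (by linarith) hzp
      have h2 := h.norm_tentExtension_sub_le hε1 hE hπE hπ (hπE x) (r := 2 * R) (z := x)
        (by linarith) (by linarith)
      have hnear := h.1.near (hπE x) (hπE x) (r := 2 * R) (s := R) (by linarith) hR0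
        (by simp [hR0.le]) le_rfl (by linarith)
      have h3 := hnear.norm_sub_le_right (by linarith)
      have h4 := hnear.norm_le_right (by linarith)
      change ‖F z - A p (2 * R) z‖ ≤ C * (ε * ‖(A p (2 * R)).contLinear‖ * (2 * R)) at h1
      change ‖F x - A p (2 * R) x‖ ≤ C * (ε * ‖(A p (2 * R)).contLinear‖ * (2 * R)) at h2
      set a := ‖(A p R).contLinear‖ with ha
      have ha0 : 0 ≤ a := norm_nonneg _
      have h5 : ‖(A p (2 * R)).contLinear‖ ≤ 2 * a := h4.trans (by gcongr; linarith)
      have h6 : ‖((A p (2 * R)).contLinear - (A p R).contLinear) (z - x)‖ ≤ ε * a * R := by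
        refine (ContinuousLinearMap.le_opNorm _ _).trans ?_
        rw [← dist_eq_norm z x]
        rw [add_sub_cancel_left] at h3
        have := hzx.trans hrR
        gcongr
      have h7 : C * (ε * ‖(A p (2 * R)).contLinear‖ * (2 * R)) ≤ C * (ε * (2 * a) * (2 * R)) := by
        gcongr
      have e : F z - F x - (A p R).contLinear (z - x) = (F z - A p (2 * R) z) -
          (F x - A p (2 * R) x) + ((A p (2 * R)).contLinear - (A p R).contLinear) (z - x) := by
        have i := (A p (2 * R)).contLinear_map_vsub z x
        simp only [vsub_eq_sub] at i
        rw [sub_apply, i]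
        abel
      rw [e]
      have t1 := norm_add_le ((F z - A p (2 * R) z) - (F x - A p (2 * R) x))
        (((A p (2 * R)).contLinear - (A p R).contLinear) (z - x))
      have t2 := norm_sub_le (F z - A p (2 * R) z) (F x - A p (2 * R) x)
      have h8 : 0 ≤ ε * a * R := by positivity
      -- Two blend errors of `4 * C` each and one change of scale give 9; `R ≤ 2 * r` doubles it to
      -- 18.
      calc _ ≤ 8 * C * (ε * a * R) + 1 * (ε * a * R) := by linarith
        _ ≤ 8 * C' * (ε * a * R) + C' * (ε * a * R) := by gcongr; linarith
        _ = 9 * C' * (ε * a * R) := by ring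
        _ ≤ 9 * C' * (ε * a * (2 * r)) := by gcongr
        _ = _ := by ring

end Extension

/-! ### The main theorem -/

theorem affSingularValue_congr {n N k : ℕ} {A B : Euc n →ᴬ[ℝ] Euc N}
    (h : A.contLinear = B.contLinear) : affSingularValue k A = affSingularValue k B := by
  unfold affSingularValue
  rw [h]

theorem theorem7p2 (n : ℕ) (hn : 1 ≤ n) :
    ∃ C₁ : ℝ, 0 < C₁ ∧ ∀ H ρ : ℝ, 1 ≤ H → 1 < ρ → ρ ≤ 2 →
      ∃ ε₁ : ℝ, 0 < ε₁ ∧ ∀ N : ℕ, n ≤ N →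
        ∀ (E : Set (Euc n)) (f : Euc n → Euc N) (A : Euc n → ℝ → (Euc n →ᴬ[ℝ] Euc N)) (ε : ℝ),
          IsClosed E → E ≠ Set.univ →
          (∃ x ∈ E, ∃ y ∈ E, f x ≠ f y) →
          ε ≤ ε₁ → IsAlmostAffine ε f E A →
          (∀ x ∈ E, ∀ r > 0, affSingularValue n (A x r) ≤ H * affSingularValue 1 (A x r)) →
          ∃ (F : Euc n → Euc N) (A' : Euc n → ℝ → (Euc n →ᴬ[ℝ] Euc N)),
            (∀ x ∈ E, F x = f x) ∧
            (∀ x ∈ E, ∀ r > 0, A' x r = A x r) ∧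
            IsAlmostAffineOver (C₁ * ε) F Set.univ ∧
            IsAlmostAffine (C₁ * ε) F Set.univ A' ∧
            IsWeaklyQuasisymmetricWith (ρ * H) F ∧
            (∀ x : Euc n, ∀ r > 0,
              affSingularValue n (A' x r) ≤ (ρ + 1) / 2 * H * affSingularValue 1 (A' x r)) := by
  have hC := two_pow_nine_le_blendConst n
  have hP := tentConst_nonneg n
  set C₁ := 18 * ((tentConst n + 6) * blendConst n) with hC₁
  have hC₁1 : 1 ≤ C₁ := by nlinarith
  refine ⟨C₁, by linarith, fun H ρ hH hρ hρ2 => ?_⟩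
  have hden : 0 < 2 * (1 + ρ * H) := by positivity
  -- With `δ = C₁ * ε`, the requirement `1 + 2 * δ ≤ ρ * (1 - 2 * δ * H)` rearranges to `2 * δ * (1
  -- + ρ * H) ≤ ρ - 1`.
  refine ⟨(ρ - 1) / (2 * (1 + ρ * H)) / C₁,
    div_pos (div_pos (by linarith) hden) (by linarith), ?_⟩
  intro N _ E f A ε hE _ hf hε₁ h hsv
  have hε := h.1.1
  have hδ : C₁ * ε ≤ (ρ - 1) / (2 * (1 + ρ * H)) := by
    rwa [le_div_iff₀ (by linarith), mul_comm] at hε₁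
  rw [le_div_iff₀ hden] at hδ
  have hρH : 1 ≤ ρ * H := by nlinarith
  have hδ1 : C₁ * ε ≤ 1 / 2 := by nlinarith
  have hε1 : ε ≤ 1 := by nlinarith
  have hne : E.Nonempty := let ⟨x, hx, _⟩ := hf; ⟨x, hx⟩
  choose π hπE hπ using fun x => hE.exists_infDist_eq_dist hne x
  have hext := h.extension hε1 hE hπE hπ
  set F := tentExtension E f A π
  have hlin : ∀ x, ∀ r > 0, (extendedFamily E F A π x r).contLinear =
      (A (π x) (max r (Metric.infDist x E))).contLinear := fun x r hr =>
    extendedFamily_contLinear hπ x hr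
  have hsv' : ∀ x, ∀ r > 0, affSingularValue n (extendedFamily E F A π x r) ≤
      H * affSingularValue 1 (extendedFamily E F A π x r) := by
    intro x r hr
    rw [affSingularValue_congr (hlin x r hr), affSingularValue_congr (hlin x r hr)]
    exact hsv _ (hπE x) _ (lt_max_of_lt_left hr)
  refine ⟨F, extendedFamily E F A π, fun x hx => tentExtension_of_mem hx,
    fun x hx r _ => by simp [extendedFamily, hx], ⟨_, hext⟩, hext, ?_, fun x r hr => ?_⟩
  · refine hext.isWeaklyQuasisymmetricWith hn hH hρ.le (by linarith) hδ1 (fun x r hr => ?_)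
      fun x r hr v => norm_contLinear_mul_norm_le hn (by linarith) (hsv' x r hr) v
    rw [hlin x r hr]
    exact h.contLinear_ne_zero hf (hπE x) (lt_max_of_lt_left hr)
  -- The new family keeps the distortion bound `H` itself, and `1 ≤ (ρ + 1) / 2`.
  · refine (hsv' x r hr).trans (mul_le_mul_of_nonneg_right ?_ (LinearMap.singularValues_nonneg _ _))
    nlinarith
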